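/- All graphs are finite and simple, and graphs are considered up to isomorphism. Let $\alpha(G)$ denote the independence number of $G$ (the maximum size of a set of pairwise non-adjacent vertices). The strong product $G\boxtimes W$ has vertex set $V(G)\times V(W)$, and two distinct vertices $(u_1,v_1),(u_2,v_2)$ are adjacent if and only if $u_1$ and $u_2$ are equal or adjacent in $G$, and $v_1$ and $v_2$ are equal or adjacent in $W$. The relative fractional packing number is $$\alpha^*(G|H)=\sup_W\frac{\alpha(G\boxtimes W)}{\alpha(H\boxtimes W)}\in[0,\infty],$$ where $W$ ranges over all graphs with at least one vertex (in the degenerate case that $H$ has no vertices, $a/0$ is read as $\infty$ for $a>0$ and $0/0$ as $0$). Let $\mathrm{Expand}(H)$ be the set of all graphs that can be obtained from $H$ by a finite (possibly empty) sequence of the following operations: (1) remove a vertex; (2) add a new edge between two distinct non-adjacent vertices; (3) replace a vertex $v$ by a clique of arbitrary size $k\ge 1$, all of whose vertices are joined to all neighbours of $v$. A graph is perfect if the chromatic number of each of its induced subgraphs equals the size of a largest clique of that subgraph. Theorem. If $G$ is a perfect graph and $H$ is an arbitrary graph, then $\alpha^*(G|H)\le 1$ if and only if $G\in\mathrm{Expand}(H)$.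 -/

import Mathlib

open scoped ENNReal

universe u v

namespace SimpleGraph

/-- The strong product of two graphs. -/
def strongProduct {V : Type u} {W : Type v} (G : SimpleGraph V) (H : SimpleGraph W) :
    SimpleGraph (V × W) where
  Adj p q :=
    (G.Adj p.1 q.1 ∧ H.Adj p.2 q.2) ∨ (p.1 = q.1 ∧ H.Adj p.2 q.2) ∨ (G.Adj p.1 q.1 ∧ p.2 = q.2)
  symm := ⟨by
    rintro p q (⟨h1, h2⟩ | ⟨h1, h2⟩ | ⟨h1, h2⟩)
    · exact Or.inl ⟨h1.symm, h2.symm⟩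
    · exact Or.inr (Or.inl ⟨h1.symm, h2.symm⟩)
    · exact Or.inr (Or.inr ⟨h1.symm, h2.symm⟩)⟩
  loopless := ⟨by
    rintro p (⟨h1, _⟩ | ⟨_, h2⟩ | ⟨h1, _⟩)
    · exact h1.ne rfl
    · exact h2.ne rfl
    · exact h1.ne rfl⟩

/-- A graph is perfect if the chromatic number of each induced subgraph equals
the maximum size of a clique in it. -/
def IsPerfect {V : Type u} (G : SimpleGraph V) : Prop :=
  ∀ s : Set V, (G.induce s).chromaticNumber = ((G.induce s).cliqueNum : ℕ∞)

/-- The relative fractional packing number: the supremum, over all finite graphs `W` with at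
least one vertex (up to isomorphism, the graphs on `Fin n` with `0 < n`), of the ratio of the
independence numbers of the strong products of `G` and of `H` with `W`. The denominator is
positive as soon as `H` has a vertex; otherwise `a / 0` is `∞` for `a ≠ 0`, and `0 / 0` is `0`. -/
noncomputable def relFracPacking {V : Type u} {V' : Type v}
    (G : SimpleGraph V) (H : SimpleGraph V') : ℝ≥0∞ :=
  ⨆ (n : ℕ) (_ : 0 < n) (W : SimpleGraph (Fin n)),
    ((G.strongProduct W).indepNum : ℝ≥0∞) / ((H.strongProduct W).indepNum : ℝ≥0∞)

/-- Replace the vertex `v` of `G` by a clique of size `k`, each of whose vertices is joined to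
all neighbours of `v`. -/
def replaceByClique {V : Type u} (G : SimpleGraph V) (v : V) (k : ℕ) :
    SimpleGraph ({w : V // w ≠ v} ⊕ Fin k) where
  Adj x y :=
    match x, y with
    | Sum.inl a, Sum.inl b => G.Adj a.1 b.1
    | Sum.inl a, Sum.inr _ => G.Adj a.1 v
    | Sum.inr _, Sum.inl b => G.Adj v b.1
    | Sum.inr i, Sum.inr j => i ≠ j
  symm := ⟨by
    rintro (a | i) (b | j) h
    · exact SimpleGraph.Adj.symm h
    · exact SimpleGraph.Adj.symm h
    · exact SimpleGraph.Adj.symm h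
    · exact Ne.symm h⟩
  loopless := ⟨by
    rintro (a | i) h
    · exact G.ne_of_adj h rfl
    · exact h rfl⟩

/-- `ExpandsTo H K`: the graph `K` is the result of a finite sequence of operations on `H`, each
of them the removal of a vertex, the addition of a new edge, or the replacement of a vertex by a
clique of positive size. -/
inductive ExpandsTo {V₀ : Type u} (H : SimpleGraph V₀) :
    {V : Type u} → SimpleGraph V → Prop
  | refl : ExpandsTo H H
  | removeVertex {V : Type u} {K : SimpleGraph V} (v : V) (hK : ExpandsTo H K) :
      ExpandsTo H (K.induce {w : V | w ≠ v})
  | addEdge {V : Type u} {K : SimpleGraph V} (a b : V) (hne : a ≠ b) (hab : ¬ K.Adj a b)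
      (hK : ExpandsTo H K) : ExpandsTo H (K ⊔ SimpleGraph.edge a b)
  | replaceByClique {V : Type u} {K : SimpleGraph V} (v : V) (k : ℕ) (hk : 0 < k)
      (hK : ExpandsTo H K) : ExpandsTo H (K.replaceByClique v k)

/-- `Expand H`: the graphs (up to isomorphism) that can be obtained from `H` by a finite sequence
of the three operations. -/
def Expand {V' : Type v} (H : SimpleGraph V') {V : Type u} : Set (SimpleGraph V) :=
  {G | ∃ (U : Type v) (K : SimpleGraph U), ExpandsTo H K ∧ Nonempty (G ≃g K)}

end SimpleGraph

/-!
Both sides turn out to be equivalent to the existence of a homomorphism `Gᶜ →g Hᶜ`, that is, of a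
map under which distinct nonadjacent vertices of `G` become distinct nonadjacent vertices of `H`.

For `Expand H` this holds for every finite graph `G`. Each operation induces such a map in the
backward direction (`ExpandsTo.nonempty_compl_hom`). Conversely, given `f : Gᶜ →g Hᶜ`, replacing
each vertex of `H` by a clique on its fibre under `f` (and removing it when the fibre is empty)
gives a spanning subgraph of `G`, from which `G` arises by adding edges
(`mem_Expand_of_compl_hom`).

A homomorphism `Gᶜ →g Hᶜ` induces one between the complements of `G ⊠ W` and `H ⊠ W`, so the
independence number can only grow from `G ⊠ W` to `H ⊠ W`, and the relative fractional packing
number is at most `1`. Conversely, if it is at most `1`, taking for `W` a single vertex yields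
`α(G) ≤ α(H)`. When `G` is perfect, the weak perfect graph theorem says that `Gᶜ` can be coloured
with `α(G)` colours; using the vertices of a maximum independent set of `H` as colours, such a
colouring is a homomorphism `Gᶜ →g Hᶜ`.

The weak perfect graph theorem (`IsPerfect.colorable_compl`) is proved by Gasparian's linear
algebra argument (`exists_coloring_of_card_le_mul`). Perfection gives `|s| ≤ α(s) ω(s)` for every
vertex set `s`, a condition that is symmetric under complements. In a vertex-minimal graph
with this property whose clique number is smaller than its chromatic number, colourings of the
graphs with one vertex removed provide `α ω + 1` independent sets, and each of them misses a clique
of size `ω` which meets all the others in one vertex. The resulting incidence matrices have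
product `J - 1`, which is nonsingular, so the graph has at least `α ω + 1` vertices, a contradiction.
-/

namespace SimpleGraph

/-! ### The weak perfect graph theorem -/

/-- The incidence matrix of the `K i` times that of the `S j` is the all-ones matrix minus the
identity, which is nonsingular as soon as it has size at least two. Hence the indicator functions
of the `S j` are linearly independent, and there are at most as many of them as points. -/
lemma card_le_card_of_card_inter_eq_ite {ι : Type*} [Fintype ι] [DecidableEq ι] {V : Type*}
    [DecidableEq V] (s : Finset V) (S K : ι → Finset V) (hK : ∀ i, K i ⊆ s)
    (h : ∀ i j, (K i ∩ S j).card = if i = j then 0 else 1) (hι : 2 ≤ Fintype.card ι) :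
    Fintype.card ι ≤ s.card := by
  have hli : LinearIndependent ℚ (fun j (x : s) => if x.1 ∈ S j then (1 : ℚ) else 0) := by
    rw [Fintype.linearIndependent_iff]
    intro g hg
    have hrow : ∀ x ∈ s, ∑ j, g j * (if x ∈ S j then (1 : ℚ) else 0) = 0 := by
      intro x hx
      simpa using congr_fun hg ⟨x, hx⟩
    have hsum : ∀ i, ∑ j, g j = g i := by
      intro i
      have h0 : ∑ x ∈ K i, ∑ j, g j * (if x ∈ S j then (1 : ℚ) else 0) = 0 :=
        Finset.sum_eq_zero fun x hx => hrow x (hK i hx)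
      rw [Finset.sum_comm] at h0
      have h1 : ∀ j, ∑ x ∈ K i, g j * (if x ∈ S j then (1 : ℚ) else 0) =
          g j - (if i = j then g j else 0) := by
        intro j
        rw [← Finset.mul_sum, Finset.sum_ite_mem, Finset.sum_const, h]
        split_ifs <;> simp
      simp only [h1, Finset.sum_sub_distrib, Finset.sum_ite_eq, Finset.mem_univ, if_true] at h0
      linarith
    -- All coefficients equal their sum, so the sum is `card ι` times itself.
    have htot : ∑ j, g j = Fintype.card ι * ∑ j, g j := by
      conv_lhs => rw [Finset.sum_congr rfl fun i _ => (hsum i).symm]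
      simp
    have hι' : (2 : ℚ) ≤ Fintype.card ι := by exact_mod_cast hι
    have hzero : ∑ j, g j = 0 := by
      have : (Fintype.card ι - 1 : ℚ) * ∑ j, g j = 0 := by linarith
      rcases mul_eq_zero.1 this with h' | h'
      · linarith
      · exact h'
    intro i
    rw [← hsum i, hzero]
  simpa using hli.fintype_card_le_finrank

lemma card_inter_le_one_of_isClique_of_isIndepSet {V : Type*} [DecidableEq V] {G : SimpleGraph V}
    {K A : Finset V} (hK : G.IsClique K) (hA : G.IsIndepSet A) : (K ∩ A).card ≤ 1 := by
  rw [Finset.card_le_one]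
  intro x hx y hy
  rw [Finset.mem_inter] at hx hy
  by_contra hne
  exact hA hx.2 hy.2 hne (hK hx.1 hy.1 hne)

/-- A colouring of the vertices outside an independent set extends to that set with one more
colour. -/
lemma exists_coloring_of_sdiff {V : Type*} [DecidableEq V] {G : SimpleGraph V} {s T : Finset V}
    {k : ℕ} (hT : G.IsIndepSet T)
    (h : ∃ c : V → ℕ, (∀ x ∈ s \ T, c x < k) ∧
      ∀ x ∈ s \ T, ∀ y ∈ s \ T, G.Adj x y → c x ≠ c y) :
    ∃ c : V → ℕ, (∀ x ∈ s, c x < k + 1) ∧ ∀ x ∈ s, ∀ y ∈ s, G.Adj x y → c x ≠ c y := by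
  obtain ⟨c, hlt, hc⟩ := h
  refine ⟨fun x => if x ∈ T then k else c x, fun x hx => ?_, fun x hx y hy hxy => ?_⟩
  · by_cases hxT : x ∈ T
    · simp [hxT]
    · simpa [hxT] using (hlt x (by simp [hx, hxT])).trans (Nat.lt_succ_self k)
  · by_cases hxT : x ∈ T <;> by_cases hyT : y ∈ T
    · exact absurd hxy (hT hxT hyT hxy.ne)
    · simpa [hxT, hyT] using (hlt y (by simp [hy, hyT])).ne'
    · simpa [hxT, hyT] using (hlt x (by simp [hx, hxT])).ne
    · simpa [hxT, hyT] using hc x (by simp [hx, hxT]) y (by simp [hy, hyT]) hxy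

/-- Gasparian's form of Lovász's theorem: if every vertex set `s` has at most as many elements as
the product of its independence and clique numbers, then every vertex set can be coloured with as
many colours as its largest clique has vertices. The hypothesis is invariant under taking
complements, which is what yields the weak perfect graph theorem. -/
theorem exists_coloring_of_card_le_mul {V : Type*} [DecidableEq V] {G : SimpleGraph V}
    (h : ∀ s : Finset V, ∃ A ⊆ s, ∃ K ⊆ s,
      G.IsIndepSet (A : Set V) ∧ G.IsClique (K : Set V) ∧ s.card ≤ A.card * K.card)
    (s : Finset V) (k : ℕ) (hk : ∀ K ⊆ s, G.IsClique (K : Set V) → K.card ≤ k) :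
    ∃ c : V → ℕ, (∀ x ∈ s, c x < k) ∧ ∀ x ∈ s, ∀ y ∈ s, G.Adj x y → c x ≠ c y := by
  induction s using Finset.strongInduction generalizing k with
  | H s ih =>
  rcases s.eq_empty_or_nonempty with rfl | ⟨v, hv⟩
  · exact ⟨fun _ => 0, by simp, by simp⟩
  by_contra hcol
  have hk1 : 1 ≤ k := by simpa using hk {v} (by simpa using hv) (by simp)
  -- Otherwise the vertices outside `T` could be coloured with `k - 1` colours.
  have key : ∀ T ⊆ s, T.Nonempty → G.IsIndepSet (T : Set V) →
      ∃ K ⊆ s \ T, G.IsClique (K : Set V) ∧ K.card = k := by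
    intro T hTs hTne hT
    by_contra! hno
    have hss : s \ T ⊂ s := Finset.sdiff_ssubset hTs hTne
    have := ih (s \ T) hss (k - 1) fun K hK hKc =>
      Nat.le_sub_one_of_lt (lt_of_le_of_ne (hk K (hK.trans hss.subset) hKc) (hno K hK hKc))
    have := exists_coloring_of_sdiff hT this
    rw [Nat.sub_add_cancel hk1] at this
    exact hcol this
  have key' : ∀ T ⊆ s, G.IsIndepSet (T : Set V) →
      ∃ K ⊆ s, Disjoint K T ∧ G.IsClique (K : Set V) ∧ K.card = k := by
    intro T hTs hT
    rcases T.eq_empty_or_nonempty with rfl | hTne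
    · obtain ⟨K, hKs, hK⟩ := key {v} (by simpa using hv) (by simp) (by simp)
      exact ⟨K, hKs.trans Finset.sdiff_subset, by simp, hK⟩
    · obtain ⟨K, hKs, hK⟩ := key T hTs hTne hT
      exact ⟨K, hKs.trans Finset.sdiff_subset,
        Finset.disjoint_of_subset_left hKs Finset.sdiff_disjoint, hK⟩
  obtain ⟨A, hAs, K₀, hK₀s, hA, hK₀, hcard⟩ := h s
  have hApos : 1 ≤ A.card := by
    by_contra! hA0
    have : s.card = 0 := by simpa [Nat.lt_one_iff.1 hA0] using hcard
    exact (Finset.card_pos.2 ⟨v, hv⟩).ne' this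
  have hcol' : ∀ a : A, ∃ c : V → ℕ, (∀ x ∈ s.erase a, c x < k) ∧
      ∀ x ∈ s.erase a, ∀ y ∈ s.erase a, G.Adj x y → c x ≠ c y := fun a =>
    ih _ (Finset.erase_ssubset (hAs a.2)) k fun K hK => hk K (hK.trans (Finset.erase_subset _ _))
  choose c hlt hc using hcol'
  -- The independent set `A` together with the `k` colour classes of each of the `s.erase a`.
  let S : Option (A × Fin k) → Finset V := fun o =>
    o.elim A fun p => (s.erase p.1).filter fun x => c p.1 x = p.2
  have hSs : ∀ o, S o ⊆ s := by
    rintro (_ | p)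
    · exact hAs
    · exact (Finset.filter_subset _ _).trans (Finset.erase_subset _ _)
  have hS : ∀ o, G.IsIndepSet (S o : Set V) := by
    rintro (_ | p)
    · exact hA
    · intro x hx y hy _ hxy
      have hx' := Finset.mem_filter.1 (Finset.mem_coe.1 hx)
      have hy' := Finset.mem_filter.1 (Finset.mem_coe.1 hy)
      exact hc p.1 x hx'.1 y hy'.1 hxy (hx'.2.trans hy'.2.symm)
  choose K hKs hKS hK hKk using fun o => key' (S o) (hSs o) (hS o)
  -- Each vertex of `K i` lies in exactly `A.card` of the sets `S j`.
  have hfib : ∀ i (a : A), ∑ b : Fin k, (K i ∩ S (some (a, b))).card = ((K i).erase a).card := by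
    intro i a
    have hmaps : ∀ x ∈ (K i).erase a.1, c a x ∈ Finset.range k := fun x hx =>
      Finset.mem_range.2 (hlt a x (Finset.erase_subset_erase _ (hKs i) hx))
    rw [Finset.card_eq_sum_card_fiberwise hmaps, Finset.sum_range]
    refine Finset.sum_congr rfl fun b _ => congrArg Finset.card ?_
    ext x
    have := @hKs i x
    simp only [S, Option.elim, Finset.mem_inter, Finset.mem_filter, Finset.mem_erase]
    tauto
  have htotal : ∀ i, ∑ j, (K i ∩ S j).card = A.card * k := by
    intro i
    have herase : ∀ a, ((K i).erase a).card + (if a ∈ K i then 1 else 0) = k := by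
      intro a
      split_ifs with ha
      · rw [Finset.card_erase_add_one ha, hKk]
      · rw [Finset.erase_eq_of_notMem ha, hKk, add_zero]
    have hinter : (K i ∩ A).card = ∑ a : A, if a.1 ∈ K i then 1 else 0 := by
      rw [Finset.sum_coe_sort A fun a => if a ∈ K i then 1 else 0, Finset.sum_boole,
        Finset.filter_mem_eq_inter, Finset.inter_comm]
      rfl
    rw [Fintype.sum_option, Fintype.sum_prod_type]
    simp only [hfib]
    change (K i ∩ A).card + _ = _
    rw [hinter, ← Finset.sum_add_distrib, Finset.sum_congr rfl fun a _ =>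
      (add_comm _ _).trans (herase a.1)]
    simp
  have hle : ∀ i j, (K i ∩ S j).card ≤ 1 := fun i j =>
    card_inter_le_one_of_isClique_of_isIndepSet (hK i) (hS j)
  have hcardι : Fintype.card (Option (A × Fin k)) = A.card * k + 1 := by simp
  have hii : ∀ i, (K i ∩ S i).card = 0 := fun i => by
    rw [Finset.disjoint_iff_inter_eq_empty.1 (hKS i), Finset.card_empty]
  -- The `A.card * k` summands with `j ≠ i` are at most one and add up to `A.card * k`.
  have hij : ∀ i j, (K i ∩ S j).card = if i = j then 0 else 1 := by
    intro i j
    have hsum : ∑ j, (K i ∩ S j).card = ∑ j, if i = j then 0 else 1 := by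
      rw [htotal, Finset.sum_ite, Finset.sum_const_zero, zero_add, Finset.sum_const,
        Finset.filter_ne, Finset.card_erase_of_mem (Finset.mem_univ i), Finset.card_univ, hcardι]
      simp
    refine (Finset.sum_eq_sum_iff_of_le fun j _ => ?_).1 hsum j (Finset.mem_univ j)
    split_ifs with hj
    · rw [← hj, hii]
    · exact hle i j
  have h2 : 2 ≤ Fintype.card (Option (A × Fin k)) := by
    rw [hcardι]
    have := Nat.mul_le_mul hApos hk1
    omega
  have := card_le_card_of_card_inter_eq_ite s S K hKs hij h2
  rw [hcardι] at this
  have := Nat.mul_le_mul_left A.card (hk K₀ hK₀s hK₀)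
  omega

/-- The complement of a perfect graph can be coloured with `G.indepNum` colours: this is the weak
perfect graph theorem, for the whole vertex set. -/
theorem IsPerfect.colorable_compl {V : Type*} [Finite V] {G : SimpleGraph V} (hG : G.IsPerfect) :
    Gᶜ.Colorable G.indepNum := by
  classical
  have := Fintype.ofFinite V
  have hmul : ∀ s : Finset V, ∃ A ⊆ s, ∃ K ⊆ s,
      Gᶜ.IsIndepSet (A : Set V) ∧ Gᶜ.IsClique (K : Set V) ∧ s.card ≤ A.card * K.card := by
    intro s
    have hcol : (G.induce (s : Set V)).Colorable (G.induce (s : Set V)).cliqueNum :=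
      chromaticNumber_le_iff_colorable.1 (hG s).le
    obtain ⟨C⟩ := hcol
    obtain ⟨A, hA⟩ := (G.induce (s : Set V)).exists_isNClique_cliqueNum
    obtain ⟨B, hB⟩ := (G.induce (s : Set V)).exists_isNIndepSet_indepNum
    refine ⟨A.map (Function.Embedding.subtype _), ?_, B.map (Function.Embedding.subtype _), ?_,
      ?_, ?_, ?_⟩
    · intro x hx
      obtain ⟨y, _, rfl⟩ := Finset.mem_map.1 hx
      exact y.2
    · intro x hx
      obtain ⟨y, _, rfl⟩ := Finset.mem_map.1 hx
      exact y.2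
    · rw [isIndepSet_compl, Finset.coe_map]
      rintro _ ⟨x, hx, rfl⟩ _ ⟨y, hy, rfl⟩ hxy
      exact hA.isClique hx hy fun h => hxy (congrArg Subtype.val h)
    · rw [isClique_compl, Finset.coe_map]
      rintro _ ⟨x, hx, rfl⟩ _ ⟨y, hy, rfl⟩ hxy
      exact hB.isIndepSet hx hy fun h => hxy (congrArg Subtype.val h)
    · rw [Finset.card_map, Finset.card_map, hA.card_eq, hB.card_eq, mul_comm]
      -- The colour classes are independent sets.
      have := Finset.card_le_mul_card_image_of_maps_to (s := (Finset.univ : Finset (s : Set V)))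
        (t := Finset.univ) (f := C) (fun _ _ => Finset.mem_univ _)
        (G.induce (s : Set V)).indepNum fun b _ =>
          IsIndepSet.card_le_indepNum (by
            simpa [Coloring.colorClass] using C.isIndepSet_colorClass b)
      simpa using this
  obtain ⟨c, hlt, hc⟩ := exists_coloring_of_card_le_mul hmul Finset.univ G.indepNum
    fun K _ hK => ((isClique_compl G).1 hK).card_le_indepNum
  exact ⟨Coloring.mk (fun x => ⟨c x, hlt x (Finset.mem_univ x)⟩) fun {x y} hxy h =>
    hc x (Finset.mem_univ x) y (Finset.mem_univ y) hxy (Fin.mk.inj h)⟩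

/-! ### Expansions induce homomorphisms of complements -/

/-- Each of the three operations comes with a map of the new vertices to the old ones under which
distinct nonadjacent vertices stay distinct and nonadjacent. -/
lemma ExpandsTo.nonempty_compl_hom {V₀ V : Type u} {H : SimpleGraph V₀} {K : SimpleGraph V}
    (h : ExpandsTo H K) : Nonempty (Kᶜ →g Hᶜ) := by
  induction h with
  | refl => exact ⟨Hom.id⟩
  | removeVertex v _ ih =>
    obtain ⟨f⟩ := ih
    refine ⟨f.comp ⟨Subtype.val, fun {x y} hxy => ?_⟩⟩
    rw [compl_adj] at hxy ⊢
    exact ⟨fun h => hxy.1 (Subtype.ext h), hxy.2⟩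
  | addEdge a b _ _ _ ih =>
    obtain ⟨f⟩ := ih
    exact ⟨f.comp (Hom.ofLE (compl_le_compl le_sup_left))⟩
  | @replaceByClique V K v k _ _ ih =>
    obtain ⟨f⟩ := ih
    refine ⟨f.comp ⟨Sum.elim Subtype.val fun _ => v, fun {x y} hxy => ?_⟩⟩
    rw [compl_adj] at hxy ⊢
    obtain ⟨hne, hadj⟩ := hxy
    rcases x with x | i <;> rcases y with y | j
    · exact ⟨fun h => hne (congrArg Sum.inl (Subtype.ext h)), hadj⟩
    · exact ⟨x.2, hadj⟩
    · exact ⟨y.2.symm, hadj⟩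
    · exact absurd (fun h => hne (congrArg Sum.inr h)) hadj

lemma nonempty_compl_hom_of_mem_Expand {V : Type u} {V' : Type v} {G : SimpleGraph V}
    {H : SimpleGraph V'} (h : G ∈ H.Expand) : Nonempty (Gᶜ →g Hᶜ) := by
  obtain ⟨U, K, hK, ⟨e⟩⟩ := h
  obtain ⟨f⟩ := hK.nonempty_compl_hom
  refine ⟨f.comp ⟨e, fun {x y} hxy => ?_⟩⟩
  rw [compl_adj] at hxy ⊢
  exact ⟨e.injective.ne hxy.1, fun h => hxy.2 (e.map_adj_iff.1 h)⟩

/-! ### Closure properties of `Expand` -/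

lemma mem_Expand_of_iso {V : Type*} {U : Type*} {V' : Type v} {G : SimpleGraph V}
    {G' : SimpleGraph U} {H : SimpleGraph V'} (e : G ≃g G') (h : G' ∈ H.Expand) :
    G ∈ H.Expand := by
  obtain ⟨U, K, hK, ⟨φ⟩⟩ := h
  exact ⟨U, K, hK, ⟨e.trans φ⟩⟩

lemma induce_ne_mem_Expand {V : Type*} {V' : Type v} {G : SimpleGraph V} {H : SimpleGraph V'}
    (h : G ∈ H.Expand) (v : V) : G.induce {w | w ≠ v} ∈ H.Expand := by
  obtain ⟨U, K, hK, ⟨φ⟩⟩ := h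
  refine ⟨_, _, hK.removeVertex (φ v), ⟨φ.toEquiv.subtypeEquiv fun w => ?_, ?_⟩⟩
  · exact (φ.injective.ne_iff (x := w) (y := v)).symm
  · exact φ.map_adj_iff

lemma replaceByClique_mem_Expand {V : Type*} {V' : Type v} {G : SimpleGraph V}
    {H : SimpleGraph V'} (h : G ∈ H.Expand) (v : V) {k : ℕ} (hk : 0 < k) :
    G.replaceByClique v k ∈ H.Expand := by
  obtain ⟨U, K, hK, ⟨φ⟩⟩ := h
  refine ⟨_, _, hK.replaceByClique (φ v) k hk, ⟨Equiv.sumCongr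
    (φ.toEquiv.subtypeEquiv fun w => (φ.injective.ne_iff (x := w) (y := v)).symm)
    (Equiv.refl _), ?_⟩⟩
  rintro (x | i) (y | j)
  · exact φ.map_adj_iff
  · exact φ.map_adj_iff
  · exact φ.map_adj_iff
  · exact Iff.rfl

lemma sup_edge_mem_Expand {V : Type*} {V' : Type v} {G : SimpleGraph V} {H : SimpleGraph V'}
    (h : G ∈ H.Expand) {a b : V} (hne : a ≠ b) (hab : ¬ G.Adj a b) :
    G ⊔ edge a b ∈ H.Expand := by
  obtain ⟨U, K, hK, ⟨φ⟩⟩ := h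
  refine ⟨_, _, hK.addEdge (φ a) (φ b) (φ.injective.ne hne) (fun h => hab (φ.map_adj_iff.1 h)),
    ⟨φ.toEquiv, ?_⟩⟩
  intro x y
  change (K ⊔ edge (φ a) (φ b)).Adj (φ x) (φ y) ↔ _
  simp [sup_adj, edge_adj, φ.map_adj_iff]

lemma mem_Expand_of_le {V : Type*} [Finite V] {V' : Type v} {G G' : SimpleGraph V}
    {H : SimpleGraph V'} (hle : G ≤ G') (h : G ∈ H.Expand) : G' ∈ H.Expand := by
  obtain ⟨M, hGM, hM⟩ :=
    (Set.toFinite {M : SimpleGraph V | M ≤ G' ∧ M ∈ H.Expand}).exists_le_maximal ⟨hle, h⟩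
  suffices M = G' from this ▸ hM.prop.2
  refine le_antisymm hM.prop.1 fun a b hab => ?_
  by_contra hMab
  have := hM.le_of_ge (y := M ⊔ edge a b)
    ⟨sup_le hM.prop.1 ((edge_le_iff _).2 (Or.inr hab)), sup_edge_mem_Expand hM.prop.2 hab.ne hMab⟩
    le_sup_left
  exact hMab (this (Or.inr ((edge_adj ..).2 ⟨Or.inl ⟨rfl, rfl⟩, hab.ne⟩)))

/-! ### Blow-ups -/

/-- The blow-up of `H` along `p : U → V'`: each vertex of `H` is replaced by a clique on its fibre
under `p`, which may be empty. -/
def blowUp {U V' : Type*} (H : SimpleGraph V') (p : U → V') : SimpleGraph U where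
  Adj x y := x ≠ y ∧ (p x = p y ∨ H.Adj (p x) (p y))
  symm := ⟨fun _ _ h => ⟨h.1.symm, h.2.imp Eq.symm Adj.symm⟩⟩
  loopless := ⟨fun _ h => h.1 rfl⟩

lemma nonempty_blowUp_iso_of_card_fiber_eq {U U' V' : Type*} [Finite U] [Finite U']
    (H : SimpleGraph V') (p : U → V') (q : U' → V')
    (h : ∀ v, Nat.card {x // p x = v} = Nat.card {y // q y = v}) :
    Nonempty (H.blowUp p ≃g H.blowUp q) := by
  let e : ∀ v, {x // p x = v} ≃ {y // q y = v} := fun v => (Finite.card_eq.1 (h v)).some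
  refine ⟨Equiv.ofFiberEquiv e, fun {x y} => ?_⟩
  change (_ ≠ _ ∧ _) ↔ (_ ≠ _ ∧ _)
  rw [Equiv.ofFiberEquiv_map e, Equiv.ofFiberEquiv_map e, (Equiv.injective _).ne_iff]

lemma induce_blowUp {U V' : Type*} (H : SimpleGraph V') (p : U → V') (s : Set U) :
    (H.blowUp p).induce s = H.blowUp fun x : s => p x := by
  ext x y
  exact and_congr_left' (not_congr Subtype.ext_iff.symm)

lemma replaceByClique_blowUp {U V' : Type*} (H : SimpleGraph V') (p : U → V') (x : U) (k : ℕ) :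
    (H.blowUp p).replaceByClique x k =
      H.blowUp (Sum.elim (fun y : {y // y ≠ x} => p y) fun _ : Fin k => p x) := by
  ext (a | i) (b | j)
  · exact and_congr_left' (not_congr (Subtype.ext_iff.symm.trans Sum.inl_injective.eq_iff.symm))
  · exact and_congr_left' (iff_of_true a.2 Sum.inl_ne_inr)
  · exact and_congr_left' (iff_of_true b.2.symm Sum.inr_ne_inl)
  · simp [replaceByClique, blowUp]

lemma card_fiber_sumElim {A B C : Type*} [Finite A] [Finite B] (f : A → C) (g : B → C) (c : C) :
    Nat.card {y // Sum.elim f g y = c} =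
      Nat.card {a // f a = c} + Nat.card {b // g b = c} := by
  rw [Nat.card_congr (Equiv.subtypeSum (p := fun y => Sum.elim f g y = c)), Nat.card_sum]
  rfl

/-- A blow-up whose fibres outside `T` are single points is reached by treating the vertices of `T`
one at a time. -/
lemma blowUp_mem_Expand_of_card_fiber_eq_one {V' : Type v} {H : SimpleGraph V'} (T : Finset V')
    {U : Type u} [Finite U] (p : U → V')
    (hp : ∀ v ∉ T, Nat.card {x // p x = v} = 1) : H.blowUp p ∈ H.Expand := by
  classical
  induction T using Finset.induction_on generalizing U with
  | empty =>
    have hbij : Function.Bijective p := by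
      refine ⟨fun x y hxy => ?_, fun v => ?_⟩
      · obtain ⟨_, _⟩ := Nat.card_eq_one_iff_unique.1 (hp (p y) (Finset.notMem_empty _))
        exact congrArg Subtype.val (Subsingleton.elim (⟨x, hxy⟩ : {x // p x = p y}) ⟨y, rfl⟩)
      · obtain ⟨_, ⟨x⟩⟩ := Nat.card_eq_one_iff_unique.1 (hp v (Finset.notMem_empty _))
        exact ⟨x, x.2⟩
    refine ⟨V', H, .refl, ⟨Equiv.ofBijective p hbij, fun {x y} => ?_⟩⟩
    change H.Adj (p x) (p y) ↔ x ≠ y ∧ (p x = p y ∨ H.Adj (p x) (p y))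
    have := hbij.1.eq_iff (a := x) (b := y)
    have : H.Adj (p x) (p y) → p x ≠ p y := Adj.ne
    tauto
  | insert v T hvT ih =>
    -- Shrink the fibre over `v` to a single point, then delete or replace that point.
    let q : {x // p x ≠ v} ⊕ Unit → V' := Sum.elim (fun x => p x) fun _ => v
    have hne : ∀ w ≠ v, Nat.card {a : {x // p x ≠ v} // p a = w} = Nat.card {x // p x = w} :=
      fun w hw => Nat.card_congr
        (Equiv.subtypeSubtypeEquivSubtype (p := fun x => p x ≠ v) (q := fun x => p x = w)
          fun h => h ▸ hw)
    have hself : Nat.card {a : {x // p x ≠ v} // p a = v} = 0 := by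
      have : IsEmpty {a : {x // p x ≠ v} // p a = v} := ⟨fun a => a.1.2 a.2⟩
      exact Nat.card_of_isEmpty
    have hq : H.blowUp q ∈ H.Expand := by
      refine ih q fun w hw => ?_
      rw [card_fiber_sumElim]
      rcases eq_or_ne w v with rfl | hwv
      · simp [hself]
      · have : IsEmpty {b : Unit // v = w} := ⟨fun b => hwv b.2.symm⟩
        rw [hne w hwv, hp w (by simp [hwv, hw]), Nat.card_of_isEmpty]
    have hr : ∀ w, Nat.card {y : {y : {x // p x ≠ v} ⊕ Unit // y ≠ Sum.inr ()} // q y = w} =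
        Nat.card {a : {x // p x ≠ v} // p a = w} := by
      intro w
      refine Nat.card_congr (Equiv.ofBijective
        (fun a => ⟨⟨Sum.inl a.1, Sum.inl_ne_inr⟩, a.2⟩) ⟨fun a b hab => ?_, ?_⟩).symm
      · simpa [Subtype.ext_iff] using hab
      · rintro ⟨⟨a | _, hy⟩, hyw⟩
        · exact ⟨⟨a, hyw⟩, rfl⟩
        · exact absurd rfl hy
    rcases Nat.eq_zero_or_pos (Nat.card {x // p x = v}) with hk | hk
    · have hmem := induce_ne_mem_Expand hq (Sum.inr ())
      rw [induce_blowUp] at hmem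
      obtain ⟨e⟩ := nonempty_blowUp_iso_of_card_fiber_eq H p
        (fun y : {y : {x // p x ≠ v} ⊕ Unit | y ≠ Sum.inr ()} => q y) fun w => by
          refine Eq.trans ?_ (hr w).symm
          rcases eq_or_ne w v with rfl | hwv
          · rw [hk, hself]
          · rw [hne w hwv]
      exact mem_Expand_of_iso e hmem
    · have hmem := replaceByClique_mem_Expand hq (Sum.inr ()) hk
      rw [replaceByClique_blowUp] at hmem
      obtain ⟨e⟩ := nonempty_blowUp_iso_of_card_fiber_eq H p
        (Sum.elim (fun y : {y : {x // p x ≠ v} ⊕ Unit // y ≠ Sum.inr ()} => q y)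
          fun _ : Fin (Nat.card {x // p x = v}) => q (Sum.inr ())) fun w => by
          rw [card_fiber_sumElim, hr]
          change _ = _ + Nat.card {_b : Fin (Nat.card {x // p x = v}) // v = w}
          rcases eq_or_ne w v with rfl | hwv
          · simp [hself]
          · simp [hne w hwv, hwv.symm]
      exact mem_Expand_of_iso e hmem

/-- `Expand H` consists of the finite graphs whose complement maps homomorphically to that of
`H`: such a graph contains a blow-up of `H` as a spanning subgraph. -/
lemma mem_Expand_of_compl_hom {V : Type u} {V' : Type v} [Finite V] [Finite V']
    {G : SimpleGraph V} {H : SimpleGraph V'} (f : Gᶜ →g Hᶜ) : G ∈ H.Expand := by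
  have := Fintype.ofFinite V'
  refine mem_Expand_of_le (G := H.blowUp f) (fun x y hxy => ?_)
    (blowUp_mem_Expand_of_card_fiber_eq_one Finset.univ f fun v hv =>
      absurd (Finset.mem_univ v) hv)
  by_contra hG
  have hf := f.map_adj ((compl_adj ..).2 ⟨hxy.1, hG⟩)
  rw [compl_adj] at hf
  exact hxy.2.elim hf.1 hf.2

/-! ### Independence numbers and homomorphisms of complements -/

lemma indepNum_le_of_compl_hom {V V' : Type*} [Finite V'] {G : SimpleGraph V}
    {H : SimpleGraph V'} (f : Gᶜ →g Hᶜ) : G.indepNum ≤ H.indepNum := by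
  classical
  obtain ⟨s, hs⟩ := G.exists_isNIndepSet_indepNum
  have hadj : ∀ x ∈ s, ∀ y ∈ s, x ≠ y → Hᶜ.Adj (f x) (f y) := fun x hx y hy hxy =>
    f.map_adj ((compl_adj ..).2 ⟨hxy, hs.isIndepSet hx hy hxy⟩)
  have hinj : Set.InjOn f s := fun x hx y hy h => by
    by_contra hxy
    exact (hadj x hx y hy hxy).ne h
  rw [← hs.card_eq, ← Finset.card_image_of_injOn hinj]
  refine IsIndepSet.card_le_indepNum ?_
  rw [Finset.coe_image]
  rintro _ ⟨x, hx, rfl⟩ _ ⟨y, hy, rfl⟩ hxy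
  exact ((compl_adj ..).1 (hadj x hx y hy fun h => hxy (congrArg f h))).2

/-- A homomorphism between complements is preserved by strong products with a fixed graph. -/
def strongProductComplHom {V V' W : Type*} {G : SimpleGraph V} {H : SimpleGraph V'}
    (f : Gᶜ →g Hᶜ) (X : SimpleGraph W) : (G.strongProduct X)ᶜ →g (H.strongProduct X)ᶜ where
  toFun p := (f p.1, p.2)
  map_rel' := by
    rintro ⟨a, x⟩ ⟨b, y⟩ h
    have hf : a ≠ b ∧ ¬ G.Adj a b → f a ≠ f b ∧ ¬ H.Adj (f a) (f b) := fun h =>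
      (compl_adj ..).1 (f.map_adj ((compl_adj ..).2 h))
    have hfe : a = b → f a = f b := congrArg f
    have hX : X.Adj x y → x ≠ y := Adj.ne
    have hH : H.Adj (f a) (f b) → f a ≠ f b := Adj.ne
    simp only [compl_adj, strongProduct, ne_eq, Prod.mk.injEq] at h ⊢
    tauto

lemma indepNum_strongProduct_bot {V : Type*} [Finite V] (G : SimpleGraph V) :
    (G.strongProduct (⊥ : SimpleGraph (Fin 1))).indepNum = G.indepNum := by
  apply le_antisymm
  · refine indepNum_le_of_compl_hom ⟨Prod.fst, ?_⟩
    rintro ⟨a, i⟩ ⟨b, j⟩ h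
    obtain rfl := Subsingleton.elim i j
    simpa [compl_adj, strongProduct] using h
  · refine indepNum_le_of_compl_hom ⟨fun x => (x, 0), ?_⟩
    intro a b h
    simpa [compl_adj, strongProduct] using h

/-- This includes the case of a vanishing denominator, since `a / 0 ≤ 1` in `ℝ≥0∞` forces
`a = 0`. -/
lemma relFracPacking_le_one_iff {V : Type u} {V' : Type v} (G : SimpleGraph V)
    (H : SimpleGraph V') : G.relFracPacking H ≤ 1 ↔ ∀ n, 0 < n → ∀ W : SimpleGraph (Fin n),
      (G.strongProduct W).indepNum ≤ (H.strongProduct W).indepNum := by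
  simp only [relFracPacking, iSup_le_iff]
  refine forall₃_congr fun n _ W => ?_
  rw [ENNReal.div_le_iff_le_mul (by simp) (by simp), one_mul, Nat.cast_le]

end SimpleGraph

theorem mainTheorem3 {V : Type u} {V' : Type v} [Finite V] [Finite V']
    (G : SimpleGraph V) (H : SimpleGraph V') (hG : G.IsPerfect) :
    G.relFracPacking H ≤ 1 ↔ G ∈ H.Expand := by
  rw [SimpleGraph.relFracPacking_le_one_iff]
  constructor
  · intro h
    have hle : G.indepNum ≤ H.indepNum := by
      simpa only [SimpleGraph.indepNum_strongProduct_bot] using h 1 one_pos ⊥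
    obtain ⟨c⟩ := hG.colorable_compl.mono hle
    obtain ⟨s, hs⟩ := H.exists_isNIndepSet_indepNum
    -- Use the vertices of a maximum independent set of `H` as colours.
    let e := s.equivFinOfCardEq hs.card_eq
    refine SimpleGraph.mem_Expand_of_compl_hom ⟨fun x => (e.symm (c x)).1, fun {x y} hxy => ?_⟩
    have hne : (e.symm (c x)).1 ≠ (e.symm (c y)).1 := fun h =>
      c.valid hxy (e.symm.injective (Subtype.ext h))
    exact (SimpleGraph.compl_adj ..).2 ⟨hne,
      hs.isIndepSet (e.symm (c x)).2 (e.symm (c y)).2 hne⟩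
  · intro h n _ W
    obtain ⟨f⟩ := SimpleGraph.nonempty_compl_hom_of_mem_Expand h
    exact SimpleGraph.indepNum_le_of_compl_hom (SimpleGraph.strongProductComplHom f W)
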